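/- Let $G$ be a connected (finite-dimensional, real) Lie group with identity $e$ and Lie algebra $\mathfrak g=T_eG$. Let $\mathcal X$ be a linear vector field on $G$, i.e. a smooth vector field whose flow $(\varphi_t)_{t\in\mathbb R}$ is globally defined and consists of automorphisms of $G$. Let $\mathcal D:\mathfrak g\to\mathfrak g$ be its associated derivation, $\mathcal D(Y)=-[\mathcal X,Y](e)$, where $Y\in\mathfrak g$ is identified with the left invariant vector field it generates. For an eigenvalue $\alpha\in\mathbb C$ of $\mathcal D$ let $\mathfrak g_\alpha$ be the generalized eigenspace of $\mathcal D$ (in the complexification of $\mathfrak g$), and let $\mathfrak g^-$ and $\mathfrak g^0$ be the real subspaces of $\mathfrak g$ consisting of the real vectors in $\bigoplus_{\mathrm{Re}\,\alpha<0}\mathfrak g_\alpha$ and in $\bigoplus_{\mathrm{Re}\,\alpha=0}\mathfrak g_\alpha$, respectively. Put $\mathfrak g^{-,0}=\mathfrak g^-\oplus\mathfrak g^0$ and let $G^{-,0}$ be the connected Lie subgroup of $G$ with Lie algebra $\mathfrak g^{-,0}$. If $G=G^{-,0}$ and the restriction $\mathcal D|_{\mathfrak g^0}$ is semisimple, then $e$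 is a stable fixed point of the flow of $\mathcal X$: $\varphi_t(e)=e$ for all $t\in\mathbb R$, and for every neighborhood $U$ of $e$ there is a neighborhood $V$ of $e$ such that $\varphi_t(V)\subset U$ for all $t\ge 0$. -/

import Mathlib

open scoped Manifold ContDiff Topology TensorProduct

universe u v

noncomputable section

namespace LinearFlow

section Spectral

variable {V : Type*} [AddCommGroup V] [Module ℝ V]

/-- The sum, inside the complexification `ℂ ⊗ V`, of the generalized eigenspaces of
(the complexification of) `T` for all eigenvalues `α` whose real part satisfies `p`. -/
def complexSpectralSubspace (T : Module.End ℝ V) (p : ℝ → Prop) : Submodule ℂ (ℂ ⊗[ℝ] V) :=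
  ⨆ (α : ℂ) (_ : p α.re), Module.End.maxGenEigenspace (T.baseChange ℂ) α

/-- The real subspace of `V` given by the generalized eigenspaces of `T` for the eigenvalues `α`
whose real part satisfies `p`: the real vectors `v` (that is, `v = 1 ⊗ v` in the
complexification) lying in the sum of the complex generalized eigenspaces. -/
def spectralSubspace (T : Module.End ℝ V) (p : ℝ → Prop) : Submodule ℝ V :=
  ((complexSpectralSubspace T p).restrictScalars ℝ).comap (TensorProduct.mk ℝ ℂ V 1)

lemma baseChange_mem_complexSpectralSubspace (T : Module.End ℝ V) (p : ℝ → Prop)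
    {x : ℂ ⊗[ℝ] V} (hx : x ∈ complexSpectralSubspace T p) :
    T.baseChange ℂ x ∈ complexSpectralSubspace T p := by
  have h : complexSpectralSubspace T p ≤
      (complexSpectralSubspace T p).comap (T.baseChange ℂ) := by
    refine iSup₂_le fun α hα y hy => ?_
    have h1 : T.baseChange ℂ y ∈ Module.End.maxGenEigenspace (T.baseChange ℂ) α :=
      Module.End.mapsTo_maxGenEigenspace_of_comm (Commute.refl _) α hy
    exact (le_iSup₂ (f := fun (β : ℂ) (_ : p β.re) =>
      Module.End.maxGenEigenspace (T.baseChange ℂ) β) α hα) h1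
  exact h hx

/-- The spectral subspaces are invariant. -/
lemma mem_spectralSubspace_of_mem (T : Module.End ℝ V) (p : ℝ → Prop) :
    ∀ v ∈ spectralSubspace T p, T v ∈ spectralSubspace T p := by
  intro v hv
  have h := baseChange_mem_complexSpectralSubspace T p (x := (1 : ℂ) ⊗ₜ[ℝ] v) hv
  rw [LinearMap.baseChange_tmul] at h
  exact h

/-- The spectral subspace of `T` for eigenvalues with negative real part. -/
def stableSubspace (T : Module.End ℝ V) : Submodule ℝ V := spectralSubspace T (· < 0)

/-- The spectral subspace of `T` for eigenvalues with zero real part. -/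
def centralSubspace (T : Module.End ℝ V) : Submodule ℝ V := spectralSubspace T (· = 0)

/-- The sum of the stable and the central subspace. -/
def stableCentralSubspace (T : Module.End ℝ V) : Submodule ℝ V :=
  stableSubspace T ⊔ centralSubspace T

/-- The restriction of `T` to its central subspace. -/
def centralRestriction (T : Module.End ℝ V) : Module.End ℝ (centralSubspace T) :=
  T.restrict (mem_spectralSubspace_of_mem T (· = 0))

end Spectral

section LieGroups

variable {E : Type v} [NormedAddCommGroup E] [NormedSpace ℝ E]
  {G : Type u} [TopologicalSpace G] [ChartedSpace E G] [Group G]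

/-- `φ` is the (global) flow of the vector field `X`: `t ↦ φ t g` is the integral curve of `X`
which starts at `g`. -/
structure IsFlowOf (X : ∀ g : G, TangentSpace 𝓘(ℝ, E) g) (φ : ℝ → G → G) : Prop where
  map_zero : ∀ g, φ 0 g = g
  isMIntegralCurve : ∀ g, IsMIntegralCurve (I := 𝓘(ℝ, E)) (fun t => φ t g) X

/-- A linear vector field (infinitesimal automorphism) on `G`: a smooth vector field which has a
global flow consisting of group automorphisms. -/
structure IsLinearVectorField [IsManifold 𝓘(ℝ, E) 1 G] (X : ∀ g : G, TangentSpace 𝓘(ℝ, E) g) : Prop where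
  contMDiff : ContMDiff 𝓘(ℝ, E) 𝓘(ℝ, E).tangent ∞
    (fun g => (⟨g, X g⟩ : TangentBundle 𝓘(ℝ, E) G))
  exists_flow : ∃ φ : ℝ → G ≃* G, IsFlowOf X (fun t g => φ t g)

/-- The derivation associated with a linear vector field `X`: the linear map
`𝒟 Y = -[X, Y](e)` on the Lie algebra of `G`, where `Y` is identified with the left invariant
vector field that it generates. -/
def derivation [FiniteDimensional ℝ E] [LieGroup 𝓘(ℝ, E) ∞ G] (X : ∀ g : G, TangentSpace 𝓘(ℝ, E) g) :
    Module.End ℝ (GroupLieAlgebra 𝓘(ℝ, E) G) where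
  toFun Y := -VectorField.mlieBracket 𝓘(ℝ, E) X (mulInvariantVectorField Y) (1 : G)
  map_add' Y Z := by
    have : CompleteSpace E := FiniteDimensional.complete ℝ E
    have : LieGroup 𝓘(ℝ, E) (minSmoothness ℝ 3) G := by
      rw [minSmoothness_of_isRCLikeNormedField]; infer_instance
    rw [mulInvariantVectorField_add, VectorField.mlieBracket_add_right
      (mdifferentiableAt_mulInvariantVectorField Y)
      (mdifferentiableAt_mulInvariantVectorField Z), neg_add]
  map_smul' c Y := by
    have : CompleteSpace E := FiniteDimensional.complete ℝ E
    have : LieGroup 𝓘(ℝ, E) (minSmoothness ℝ 3) G := by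
      rw [minSmoothness_of_isRCLikeNormedField]; infer_instance
    rw [mulInvariantVectorField_smul, VectorField.mlieBracket_const_smul_right
      (mdifferentiableAt_mulInvariantVectorField Y), smul_neg, RingHom.id_apply]

/-- `H` is the connected Lie subgroup of `G` with Lie algebra `𝔥`: it is the image of a connected
(finite-dimensional) Lie group `K` under an injective homomorphism `ι` which is a smooth immersion,
and `𝔥` is the image of the Lie algebra of `K` under the differential of `ι` at the identity.
(Lie subgroups are immersed, `H` need not be closed in `G`.) -/
def IsConnectedLieSubgroup (H : Subgroup G)
    (𝔥 : Submodule ℝ (GroupLieAlgebra 𝓘(ℝ, E) G)) : Prop :=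
  ∃ (k : ℕ) (K : Type u) (_ : TopologicalSpace K) (_ : ChartedSpace (EuclideanSpace ℝ (Fin k)) K)
    (_ : Group K) (_ : LieGroup (𝓡 k) ∞ K) (_ : ConnectedSpace K) (ι : K →* G),
    Function.Injective ι ∧
    ContMDiff (𝓡 k) 𝓘(ℝ, E) ∞ ι ∧
    (∀ x : K, Function.Injective (mfderiv (𝓡 k) 𝓘(ℝ, E) ι x)) ∧
    ι.range = H ∧
    ∀ Y : GroupLieAlgebra 𝓘(ℝ, E) G,
      Y ∈ 𝔥 ↔ ∃ Z : TangentSpace (𝓡 k) (1 : K), (mfderiv (𝓡 k) 𝓘(ℝ, E) ι 1 Z : E) = Y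

end LieGroups

/-- `x` is a stable fixed point of the flow `φ`. -/
def IsStableFixedPoint {M : Type*} [TopologicalSpace M] (φ : ℝ → M → M) (x : M) : Prop :=
  (∀ t, φ t x = x) ∧ ∀ U ∈ 𝓝 x, ∃ V ∈ 𝓝 x, ∀ t : ℝ, 0 ≤ t → φ t '' V ⊆ U

end LinearFlow

end

/-! Since the flow fixes `e`, the field vanishes there, and `𝒟` is the linearization `A` of the
field read in the chart at `e` (`derivation_eq_fderiv`). If `G^{-,0}` is all of `G`, its Lie algebra
is all of `𝔤` (`IsConnectedLieSubgroup.eq_top`), so every eigenvalue of `A` has real part at most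
zero and, by semisimplicity, the imaginary axis contributes no polynomial growth. Hence `‖exp (t A)‖
≤ C` for all `t ≥ 0` (`exists_norm_exp_smul_le`).

For a general nonlinear flow this would not imply stability: comparison with the linear equation
shows only that each `φ_t` expands distances to `e` by at most `C + 1` on a neighborhood that
depends on `t` (`eventually_norm_flow_sub_le`). The group structure removes this dependence. An
element near `e` is a product of `n` increments along a chart segment; for `n` large, depending on
`t`, they all lie in that neighborhood. As `φ_t` is a homomorphism, the images of the increments can
be multiplied back together. Each contributes an error of order `1/n`, so the total is bounded
independently of `n` and `t` (`exists_forall_image_subset_of_eventually_le`). -/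

namespace LinearFlow

/-! ### Complexification and semisimplicity on spectral subspaces. -/

section SpectralBound

open Polynomial in
/-- A generalized eigenvector annihilated by a squarefree polynomial is an eigenvector. -/
lemma apply_sub_algebraMap_eq_zero_of_squarefree {K W : Type*} [Field K] [AddCommGroup W]
    [Module K W] (T : Module.End K W) {q : K[X]} (hq : Squarefree q) {α : K} {w : W} {n : ℕ}
    (hw : ((T - algebraMap K _ α) ^ n) w = 0) (hqw : aeval T q w = 0) :
    (T - algebraMap K _ α) w = 0 := by
  -- Bézout: a vector killed by two coprime polynomials in `T` is zero.
  have key : ∀ r : K[X], ¬ (X - C α) ∣ r → ∀ y : W, ((T - algebraMap K _ α) ^ n) y = 0 →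
      aeval T r y = 0 → y = 0 := by
    intro r hr y hy hry
    obtain ⟨a, b, hab⟩ : IsCoprime ((X - C α) ^ n) r :=
      (((irreducible_X_sub_C α).coprime_iff_not_dvd).2 hr).pow_left
    have := congrArg (fun s => aeval T s y) hab
    simpa [hy, hry] using this.symm
  by_cases h : (X - C α) ∣ q
  · obtain ⟨r, rfl⟩ := h
    have hr : ¬ (X - C α) ∣ r := fun ⟨s, hs⟩ =>
      not_isUnit_X_sub_C α (hq _ ⟨s, by rw [hs, mul_assoc]⟩)
    refine key r hr _ ?_ ?_
    · rw [← Module.End.mul_apply, ← pow_succ, pow_succ', Module.End.mul_apply, hw, map_zero]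
    · rw [mul_comm] at hqw
      simpa using hqw
  · rw [key q h w hw hqw, map_zero]

lemma aeval_restrict_apply {K W : Type*} [Field K] [AddCommGroup W] [Module K W]
    (T : Module.End K W) (S : Submodule K W) (hS : ∀ x ∈ S, T x ∈ S) (q : Polynomial K) (x : S) :
    (Polynomial.aeval (T.restrict hS) q x : W) = Polynomial.aeval T q x := by
  induction q using Polynomial.induction_on' with
  | add a b ha hb => simp [ha, hb]
  | monomial n a =>
    simp only [Polynomial.aeval_monomial, Module.End.mul_apply, Module.algebraMap_end_apply]
    rw [Module.End.pow_restrict _ hS]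
    simp

variable {V : Type*} [AddCommGroup V] [Module ℝ V]

/-- The projection of the complexification onto the real part. -/
noncomputable def realPart (V : Type*) [AddCommGroup V] [Module ℝ V] : ℂ ⊗[ℝ] V →ₗ[ℝ] V :=
  (TensorProduct.lid ℝ V).toLinearMap ∘ₗ LinearMap.rTensor V Complex.reLm

@[simp] lemma realPart_tmul (z : ℂ) (v : V) : realPart V (z ⊗ₜ v) = z.re • v := by
  simp [realPart]

lemma realPart_baseChange (T : Module.End ℝ V) (x : ℂ ⊗[ℝ] V) :
    realPart V (T.baseChange ℂ x) = T (realPart V x) := by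
  induction x with
  | zero => simp
  | tmul z v => simp
  | add x y hx hy => simp [hx, hy]

lemma aeval_map_baseChange (T : Module.End ℝ V) (p : Polynomial ℝ) (v : V) :
    Polynomial.aeval (T.baseChange ℂ) (p.map (algebraMap ℝ ℂ)) ((1 : ℂ) ⊗ₜ[ℝ] v) =
      (1 : ℂ) ⊗ₜ[ℝ] (Polynomial.aeval T p v) := by
  have h1 : T.baseChange ℂ = Module.End.baseChangeHom ℝ ℂ V T := rfl
  rw [Polynomial.aeval_map_algebraMap, h1, Polynomial.aeval_algHom_apply]
  rfl

/-- Vectors of a spectral subspace on which `T` is semisimple are sums of eigenvectors. -/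
lemma mem_iSup_eigenspace_of_isSemisimple [FiniteDimensional ℝ V] (T : Module.End ℝ V)
    (p : ℝ → Prop) (hT : Module.End.IsSemisimple (T.restrict (mem_spectralSubspace_of_mem T p)))
    {v : V} (hv : v ∈ spectralSubspace T p) :
    (1 : ℂ) ⊗ₜ[ℝ] v ∈
      ⨆ α : {α : ℂ // p α.re}, Module.End.eigenspace (T.baseChange ℂ) (α : ℂ) := by
  classical
  set f : Module.End ℂ (ℂ ⊗[ℝ] V) := T.baseChange ℂ with hf
  set m := minpoly ℝ (T.restrict (mem_spectralSubspace_of_mem T p)) with hm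
  set q := m.map (algebraMap ℝ ℂ) with hq
  -- Squarefreeness survives the passage to `ℂ` because over the perfect field `ℝ` it amounts to
  -- separability.
  have hsq : Squarefree q :=
    ((PerfectField.separable_iff_squarefree.mpr hT.minpoly_squarefree).map).squarefree
  have hqv : Polynomial.aeval f q ((1 : ℂ) ⊗ₜ[ℝ] v) = 0 := by
    rw [hf, hq, aeval_map_baseChange]
    have := aeval_restrict_apply T _ (mem_spectralSubspace_of_mem T p) m ⟨v, hv⟩
    rw [hm, minpoly.aeval] at this
    rw [hm, ← this]
    simp
  have hv' : (1 : ℂ) ⊗ₜ[ℝ] v ∈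
      ⨆ α : {α : ℂ // p α.re}, Module.End.maxGenEigenspace f (α : ℂ) := by
    have : (1 : ℂ) ⊗ₜ[ℝ] v ∈ complexSpectralSubspace T p := hv
    rwa [complexSpectralSubspace, iSup_subtype'] at this
  rw [Submodule.mem_iSup_iff_exists_dfinsupp] at hv'
  obtain ⟨w, hw⟩ := hv'
  have hind : iSupIndep fun α : {α : ℂ // p α.re} => Module.End.maxGenEigenspace f (α : ℂ) :=
    (Module.End.independent_maxGenEigenspace f).comp Subtype.val_injective
  have hcomm : Commute f (Polynomial.aeval f q) := by
    have := Polynomial.aeval_X (R := ℂ) f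
    rw [Commute, SemiconjBy]
    nth_rewrite 1 4 [← this]
    rw [← map_mul, ← map_mul, mul_comm]
  have hmaps : ∀ α : {α : ℂ // p α.re}, ∀ x ∈ Module.End.maxGenEigenspace f (α : ℂ),
      Polynomial.aeval f q x ∈ Module.End.maxGenEigenspace f (α : ℂ) := fun α =>
    Module.End.mapsTo_maxGenEigenspace_of_comm hcomm _
  -- Apply `q(f)` to each component: the results sum to zero, so by independence `q(f)` kills every
  -- component separately.
  let w' : Π₀ α : {α : ℂ // p α.re}, Module.End.maxGenEigenspace f (α : ℂ) :=
    DFinsupp.mapRange.linearMap (fun α => (Polynomial.aeval f q).restrict (hmaps α)) w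
  have hw' : w' = 0 := by
    apply hind.dfinsupp_lsum_injective
    rw [map_zero, ← hqv, ← hw]
    simp only [w']
    clear hw
    induction w using DFinsupp.induction with
    | h0 => simp
    | ha i b g _ _ ih =>
      simp only [map_add, ih]
      simp
  rw [← hw]
  rw [DFinsupp.lsum_apply_apply, DFinsupp.sumAddHom_apply]
  refine Submodule.sum_mem _ fun α _ => Submodule.mem_iSup_of_mem α ?_
  have h0 : Polynomial.aeval f q (w α : ℂ ⊗[ℝ] V) = 0 := by
    have := congrArg (fun z => ((z α : Module.End.maxGenEigenspace f (α : ℂ)) : ℂ ⊗[ℝ] V)) hw'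
    simpa [w'] using this
  obtain ⟨n, hn⟩ := (Module.End.mem_maxGenEigenspace f (α : ℂ) _).1 (w α).2
  have := apply_sub_algebraMap_eq_zero_of_squarefree f hsq hn h0
  rw [Module.End.mem_eigenspace_iff]
  simpa [sub_eq_zero] using this

end SpectralBound

/-! ### Boundedness of the exponential in forward time. -/

section ExpBound

/-- The function `t ↦ exp (α t) t ^ k / k!`. -/
noncomputable def expMonomial (α : ℂ) (k : ℕ) (t : ℝ) : ℂ :=
  Complex.exp (α * t) * ((t : ℂ) ^ k / (k.factorial : ℂ))

lemma hasDerivAt_expMonomial_zero (α : ℂ) (t : ℝ) :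
    HasDerivAt (expMonomial α 0) (α * expMonomial α 0 t) t := by
  have h1 : HasDerivAt (fun t : ℝ => α * (t : ℂ)) α t := by
    simpa using (Complex.ofRealCLM.hasDerivAt (x := t)).const_mul α
  have h := h1.cexp
  unfold expMonomial
  simpa [mul_comm] using h

lemma hasDerivAt_expMonomial_succ (α : ℂ) (k : ℕ) (t : ℝ) :
    HasDerivAt (expMonomial α (k + 1)) (α * expMonomial α (k + 1) t + expMonomial α k t) t := by
  have h0 : HasDerivAt (fun t : ℝ => (t : ℂ)) 1 t := Complex.ofRealCLM.hasDerivAt (x := t)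
  have h1 : HasDerivAt (fun t : ℝ => α * (t : ℂ)) α t := by simpa using h0.const_mul α
  have h := h1.cexp.mul ((h0.pow (k + 1)).div_const ((k + 1).factorial : ℂ))
  unfold expMonomial
  convert! h using 1
  have : ((k.factorial : ℂ)) ≠ 0 := by exact_mod_cast k.factorial_ne_zero
  have : ((k : ℂ) + 1) ≠ 0 := by exact_mod_cast k.succ_ne_zero
  push_cast [Nat.factorial_succ]
  field_simp
  simp

lemma norm_expMonomial {α : ℂ} {k : ℕ} {t : ℝ} (ht : 0 ≤ t) :
    ‖expMonomial α k t‖ = Real.exp (α.re * t) * (t ^ k / k.factorial) := by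
  simp [expMonomial, Complex.norm_exp, abs_of_nonneg ht]

/-- Follows from `x ^ k / k! ≤ exp x` at `x = -α.re * t`; boundedness suffices, decay is not needed.
-/
lemma norm_expMonomial_le_of_re_neg {α : ℂ} (hα : α.re < 0) (k : ℕ) {t : ℝ} (ht : 0 ≤ t) :
    ‖expMonomial α k t‖ ≤ ((-α.re) ^ k)⁻¹ := by
  rw [norm_expMonomial ht]
  have hb : 0 < -α.re := by linarith
  have h := Real.pow_div_factorial_le_exp _ (mul_nonneg hb.le ht) k
  have h2 : Real.exp (α.re * t) * Real.exp (-α.re * t) = 1 := by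
    rw [← Real.exp_add]; simp
  rw [← one_div, le_div_iff₀ (by positivity), ← h2]
  calc _ = Real.exp (α.re * t) * ((-α.re * t) ^ k / k.factorial) := by rw [mul_pow]; ring
    _ ≤ _ := by gcongr

variable {V : Type*} [NormedAddCommGroup V] [NormedSpace ℝ V]

lemma hasDerivAt_realPart_smul (w : ℂ ⊗[ℝ] V) {c : ℝ → ℂ} {c' : ℂ} {t : ℝ}
    (hc : HasDerivAt c c' t) :
    HasDerivAt (fun s => realPart V (c s • w)) (realPart V (c' • w)) t := by
  let L : ℂ →ₗ[ℝ] V := realPart V ∘ₗ (LinearMap.toSpanSingleton ℂ (ℂ ⊗[ℝ] V) w).restrictScalars ℝ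
  exact (LinearMap.toContinuousLinearMap L).hasFDerivAt.comp_hasDerivAt t hc

lemma exists_norm_realPart_smul_le (w : ℂ ⊗[ℝ] V) :
    ∃ C, ∀ z : ℂ, ‖realPart V (z • w)‖ ≤ C * ‖z‖ := by
  let L : ℂ →ₗ[ℝ] V := realPart V ∘ₗ (LinearMap.toSpanSingleton ℂ (ℂ ⊗[ℝ] V) w).restrictScalars ℝ
  exact ⟨_, fun z => (LinearMap.toContinuousLinearMap L).le_opNorm z⟩

/-- The subspace of vectors with bounded forward orbit under `exp (t A)`. -/
def boundedSubspace (A : V →L[ℝ] V) : Submodule ℝ V where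
  carrier := {v | ∃ C, ∀ t : ℝ, 0 ≤ t → ‖NormedSpace.exp (t • A) v‖ ≤ C}
  zero_mem' := ⟨0, by simp⟩
  add_mem' := by
    rintro a b ⟨C, hC⟩ ⟨D, hD⟩
    refine ⟨C + D, fun t ht => ?_⟩
    rw [map_add]
    exact (norm_add_le _ _).trans (add_le_add (hC t ht) (hD t ht))
  smul_mem' := by
    rintro c a ⟨C, hC⟩
    refine ⟨‖c‖ * C, fun t ht => ?_⟩
    rw [map_smul, norm_smul]
    gcongr
    exact hC t ht

lemma mem_boundedSubspace_of_mem_iSup {ι : Type*} (A : V →L[ℝ] V)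
    {S : ι → Submodule ℂ (ℂ ⊗[ℝ] V)} (hS : ∀ i, ∀ w ∈ S i, realPart V w ∈ boundedSubspace A)
    {v : V} (hv : (1 : ℂ) ⊗ₜ[ℝ] v ∈ ⨆ i, S i) : v ∈ boundedSubspace A := by
  have : realPart V ((1 : ℂ) ⊗ₜ[ℝ] v) ∈ boundedSubspace A := by
    refine Submodule.iSup_induction S (motive := fun x => realPart V x ∈ boundedSubspace A) hv hS ?_
      fun x y hx hy => ?_
    · rw [map_zero]; exact zero_mem _
    · rw [map_add]; exact add_mem hx hy
  simpa using this

variable [FiniteDimensional ℝ V]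

lemma exp_smul_apply_eq_of_hasDerivAt (A : V →L[ℝ] V) {y : ℝ → V}
    (hy : ∀ t, HasDerivAt y (A (y t)) t) (t : ℝ) :
    y t = NormedSpace.exp (t • A) (y 0) := by
  have : CompleteSpace V := FiniteDimensional.complete ℝ V
  have h2 : ∀ t, HasDerivAt (fun s : ℝ => NormedSpace.exp (s • A) (y 0))
      (A (NormedSpace.exp (t • A) (y 0))) t := fun t => by
    simpa using (hasDerivAt_exp_smul_const' A t).clm_apply (hasDerivAt_const t (y 0))
  have := ODE_solution_unique_univ (v := fun _ => A) (s := fun _ => Set.univ) (t₀ := 0)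
    (f := y) (g := fun s : ℝ => NormedSpace.exp (s • A) (y 0)) (K := ‖A‖₊)
    (fun _ => A.lipschitz.lipschitzOnWith) (fun t => ⟨hy t, trivial⟩) (fun t => ⟨h2 t, trivial⟩)
    (by simp)
  exact congrFun this t

/-- The exponential of `t A` on (the real part of) a generalized eigenvector. -/
lemma exp_smul_apply_realPart (A : V →L[ℝ] V) {α : ℂ} {w : ℂ ⊗[ℝ] V} {n : ℕ}
    (hw : (((A : V →ₗ[ℝ] V).baseChange ℂ - algebraMap ℂ (Module.End ℂ (ℂ ⊗[ℝ] V)) α) ^ (n + 1)) w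
      = 0) (t : ℝ) :
    NormedSpace.exp (t • A) (realPart V w) = ∑ k ∈ Finset.range (n + 1), realPart V
      (expMonomial α k t •
        (((A : V →ₗ[ℝ] V).baseChange ℂ - algebraMap ℂ (Module.End ℂ (ℂ ⊗[ℝ] V)) α) ^ k) w) := by
  set T : Module.End ℂ (ℂ ⊗[ℝ] V) := (A : V →ₗ[ℝ] V).baseChange ℂ with hT
  set N : Module.End ℂ (ℂ ⊗[ℝ] V) := T - algebraMap ℂ _ α with hN
  have hTN : ∀ x, T x = α • x + N x := fun x => by simp [hN]
  have hAr : ∀ x, A (realPart V x) = realPart V (T x) := fun x =>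
    (realPart_baseChange (A : V →ₗ[ℝ] V) x).symm
  set y : ℝ → V := fun t => ∑ k ∈ Finset.range (n + 1), realPart V
      (expMonomial α k t • (N ^ k) w) with hy
  have h0 : y 0 = realPart V w := by
    simp only [hy, Finset.sum_range_succ']
    simp [expMonomial]
  have hd : ∀ t, HasDerivAt y (A (y t)) t := by
    intro t
    have h1 : HasDerivAt y (∑ k ∈ Finset.range (n + 1), realPart V
        ((α * expMonomial α k t + if k = 0 then 0 else expMonomial α (k - 1) t) • (N ^ k) w)) t := by
      refine HasDerivAt.fun_sum fun k _ => hasDerivAt_realPart_smul _ ?_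
      cases k with
      | zero => simpa using hasDerivAt_expMonomial_zero α t
      | succ k => simpa using hasDerivAt_expMonomial_succ α k t
    convert! h1 using 1
    simp only [hy, map_sum, hAr, map_smul, hTN, add_smul, map_add,
      Finset.sum_add_distrib, smul_smul]
    congr 1
    -- `N` shifts the index by one: the top term vanishes by `hw`, the bottom one by the `if`.
    · rw [Finset.sum_range_succ, Finset.sum_range_succ']
      simp only [← Module.End.mul_apply, ← pow_succ', hw]
      simp
  rw [← h0]
  exact (exp_smul_apply_eq_of_hasDerivAt A hd t).symm

lemma exists_norm_exp_apply_realPart_le_of_re_neg (A : V →L[ℝ] V) {α : ℂ} (hα : α.re < 0)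
    {w : ℂ ⊗[ℝ] V} (hw : w ∈ Module.End.maxGenEigenspace ((A : V →ₗ[ℝ] V).baseChange ℂ) α) :
    ∃ C, ∀ t : ℝ, 0 ≤ t → ‖NormedSpace.exp (t • A) (realPart V w)‖ ≤ C := by
  obtain ⟨n, hn⟩ := (Module.End.mem_maxGenEigenspace _ _ _).1 hw
  have hn' : (((A : V →ₗ[ℝ] V).baseChange ℂ - algebraMap ℂ (Module.End ℂ (ℂ ⊗[ℝ] V)) α) ^ (n + 1)) w
      = 0 := by
    rw [pow_succ', Module.End.mul_apply]
    erw [hn, map_zero]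
  choose C hC using fun w : ℂ ⊗[ℝ] V => exists_norm_realPart_smul_le w
  refine ⟨∑ k ∈ Finset.range (n + 1), |C ((((A : V →ₗ[ℝ] V).baseChange ℂ -
    algebraMap ℂ (Module.End ℂ (ℂ ⊗[ℝ] V)) α) ^ k) w)| * ((-α.re) ^ k)⁻¹, fun t ht => ?_⟩
  rw [exp_smul_apply_realPart A hn' t]
  refine (norm_sum_le _ _).trans (Finset.sum_le_sum fun k _ => (hC _ _).trans ?_)
  gcongr
  · exact le_abs_self _
  · exact norm_expMonomial_le_of_re_neg hα k ht

/-- For a genuine eigenvector only the term `k = 0` occurs, of modulus one; a Jordan block would add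
growing powers of `t`. -/
lemma exists_norm_exp_apply_realPart_le_of_re_eq_zero (A : V →L[ℝ] V) {α : ℂ} (hα : α.re = 0)
    {w : ℂ ⊗[ℝ] V} (hw : w ∈ Module.End.eigenspace ((A : V →ₗ[ℝ] V).baseChange ℂ) α) :
    ∃ C, ∀ t : ℝ, 0 ≤ t → ‖NormedSpace.exp (t • A) (realPart V w)‖ ≤ C := by
  have hn' : (((A : V →ₗ[ℝ] V).baseChange ℂ - algebraMap ℂ (Module.End ℂ (ℂ ⊗[ℝ] V)) α) ^ (0 + 1)) w
      = 0 := by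
    rw [Module.End.mem_eigenspace_iff] at hw
    simp [hw]
  obtain ⟨C, hC⟩ := exists_norm_realPart_smul_le w
  refine ⟨C, fun t ht => ?_⟩
  rw [exp_smul_apply_realPart A hn' t]
  simpa [norm_expMonomial ht, hα] using hC (expMonomial α 0 t)

/-- If the spectrum of `A` is contained in the closed left half plane and `A` is semisimple on the
central subspace, then `exp (t A)` is bounded for `t ≥ 0`. -/
theorem exists_norm_exp_smul_le (A : V →L[ℝ] V)
    (hA : stableCentralSubspace (A : V →ₗ[ℝ] V) = ⊤)
    (hs : (centralRestriction (A : V →ₗ[ℝ] V)).IsSemisimple) :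
    ∃ C, ∀ t : ℝ, 0 ≤ t → ‖NormedSpace.exp (t • A)‖ ≤ C := by
  have : CompleteSpace V := FiniteDimensional.complete ℝ V
  have htop : boundedSubspace A = ⊤ := by
    rw [eq_top_iff, ← hA]
    refine sup_le (fun v hv => ?_) fun v hv => ?_
    · have hv' : (1 : ℂ) ⊗ₜ[ℝ] v ∈ complexSpectralSubspace (A : V →ₗ[ℝ] V) (· < 0) := hv
      rw [complexSpectralSubspace, iSup_subtype'] at hv'
      exact mem_boundedSubspace_of_mem_iSup A
        (fun α w hw => exists_norm_exp_apply_realPart_le_of_re_neg A α.2 hw) hv'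
    · exact mem_boundedSubspace_of_mem_iSup A
        (fun α w hw => exists_norm_exp_apply_realPart_le_of_re_eq_zero A α.2 hw)
        (mem_iSup_eigenspace_of_isSemisimple (A : V →ₗ[ℝ] V) (· = 0) hs hv)
  -- Every orbit is bounded, so uniform boundedness gives a bound in operator norm.
  obtain ⟨C, hC⟩ := banach_steinhaus (ι := {t : ℝ // 0 ≤ t})
    (g := fun t => NormedSpace.exp ((t : ℝ) • A)) (fun v => by
      obtain ⟨C, hC⟩ : v ∈ boundedSubspace A := htop ▸ Submodule.mem_top
      exact ⟨C, fun t => hC t t.2⟩)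
  exact ⟨C, fun t ht => hC ⟨t, ht⟩⟩

end ExpBound

/-! ### A connected Lie subgroup that is the whole group has the full Lie algebra. -/

section FullSubgroup

open Pointwise in
/-- A connected locally compact group is `σ`-compact. -/
theorem sigmaCompactSpace_of_connectedSpace (K : Type*) [TopologicalSpace K] [Group K]
    [IsTopologicalGroup K] [WeaklyLocallyCompactSpace K] [ConnectedSpace K] :
    SigmaCompactSpace K := by
  obtain ⟨C, hC, hC1⟩ := exists_compact_mem_nhds (1 : K)
  set D : Set K := C ∪ C⁻¹ with hD
  have hDc : IsCompact D := hC.union hC.inv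
  have hDinv : D⁻¹ = D := by rw [hD, Set.union_inv, inv_inv, Set.union_comm]
  have hcl : ∀ x ∈ Subgroup.closure C, x ∈ ⋃ n : ℕ, D ^ n := by
    intro x hx
    induction hx using Subgroup.closure_induction with
    | mem x hx => exact Set.mem_iUnion.2 ⟨1, by rw [pow_one]; exact Or.inl hx⟩
    | one => exact Set.mem_iUnion.2 ⟨0, by simp⟩
    | mul x y _ _ hx hy =>
      obtain ⟨m, hm⟩ := Set.mem_iUnion.1 hx
      obtain ⟨n, hn⟩ := Set.mem_iUnion.1 hy
      exact Set.mem_iUnion.2 ⟨m + n, by rw [pow_add]; exact Set.mul_mem_mul hm hn⟩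
    | inv x _ hx =>
      obtain ⟨m, hm⟩ := Set.mem_iUnion.1 hx
      refine Set.mem_iUnion.2 ⟨m, ?_⟩
      rw [← hDinv, inv_pow]
      simpa using hm
  have hopen : IsOpen (Subgroup.closure C : Set K) :=
    Subgroup.isOpen_of_mem_nhds _ (Filter.mem_of_superset hC1 Subgroup.subset_closure)
  have huniv : (Subgroup.closure C : Set K) = Set.univ :=
    IsClopen.eq_univ ⟨Subgroup.isClosed_of_isOpen _ hopen, hopen⟩ ⟨1, one_mem _⟩
  refine ⟨⟨fun n => D ^ n, fun n => ?_, ?_⟩⟩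
  · induction n with
    | zero => simp
    | succ n ih =>
      change IsCompact (D ^ (n + 1))
      rw [pow_succ]; exact ih.mul hDc
  · refine Set.eq_univ_of_forall fun x => hcl x ?_
    have : x ∈ (Subgroup.closure C : Set K) := huniv ▸ Set.mem_univ x
    exact this

variable {E : Type v} [NormedAddCommGroup E] [NormedSpace ℝ E] [FiniteDimensional ℝ E]
  {F : Type*} [NormedAddCommGroup F] [NormedSpace ℝ F] [FiniteDimensional ℝ F]

/-- A differentiable map which is open does not raise the dimension. -/
theorem finrank_le_of_isOpenMap {M N : Type*} [TopologicalSpace M] [ChartedSpace F M]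
    [TopologicalSpace N] [ChartedSpace E N] {f : M → N} (hf : ContMDiff 𝓘(ℝ, F) 𝓘(ℝ, E) ∞ f)
    (hopen : IsOpenMap f) (x : M) : Module.finrank ℝ E ≤ Module.finrank ℝ F := by
  by_contra! hlt
  set κ := extChartAt 𝓘(ℝ, F) x
  set κ' := extChartAt 𝓘(ℝ, E) (f x)
  have h1 : ContDiffAt ℝ 1 (κ' ∘ f ∘ κ.symm) (κ x) := by
    have := (contMDiffAt_iff.1 (hf x)).2
    rw [modelWithCornersSelf_coe, Set.range_id, contDiffWithinAt_univ] at this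
    exact this.of_le (by norm_cast)
  obtain ⟨u, hu, hfu⟩ := h1.contDiffOn (m := 1) le_rfl (by simp)
  obtain ⟨r, hr, hru⟩ := Metric.mem_nhds_iff.1 (by simpa using hu : u ∈ 𝓝 (κ x))
  -- A `C^1` image has Hausdorff dimension at most `finrank F`, too small to contain an open set of
  -- `E`.
  have hd : Dense ((κ' ∘ f ∘ κ.symm) '' Metric.ball (κ x) r)ᶜ := by
    refine (hfu.mono hru).dense_compl_image_of_dimH_lt_finrank (convex_ball _ _) subset_rfl ?_
    refine (dimH_mono (Set.subset_univ _)).trans_lt ?_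
    rw [Real.dimH_univ_eq_finrank]
    exact_mod_cast hlt
  have hm : (κ' ∘ f ∘ κ.symm) '' Metric.ball (κ x) r ∈ 𝓝 (κ' (f x)) := by
    rw [Set.image_comp, Set.image_comp, ← map_extChartAt_nhds_of_boundaryless (I := 𝓘(ℝ, E))]
    refine Filter.image_mem_map (hopen.image_mem_nhds ?_)
    rw [← map_extChartAt_symm_nhdsWithin_range (I := 𝓘(ℝ, F)), modelWithCornersSelf_coe,
      Set.range_id, nhdsWithin_univ]
    exact Filter.image_mem_map (Metric.ball_mem_nhds _ hr)
  obtain ⟨y, hy, hy'⟩ := hd.inter_nhds_nonempty hm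
  exact hy hy'

/-- The Lie algebra of the whole group, considered as a Lie subgroup of itself, is everything. -/
theorem IsConnectedLieSubgroup.eq_top {G : Type u} [TopologicalSpace G] [T2Space G]
    [ChartedSpace E G] [Group G] [LieGroup 𝓘(ℝ, E) ∞ G]
    {𝔥 : Submodule ℝ (GroupLieAlgebra 𝓘(ℝ, E) G)}
    (h : IsConnectedLieSubgroup (⊤ : Subgroup G) 𝔥) : 𝔥 = ⊤ := by
  obtain ⟨k, K, _, _, _, _, _, ι, -, hsm, himm, hrange, hmem⟩ := h
  have : IsTopologicalGroup K := topologicalGroup_of_lieGroup (𝓡 k) ∞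
  have : IsTopologicalGroup G := topologicalGroup_of_lieGroup 𝓘(ℝ, E) ∞
  have : LocallyCompactSpace K := ChartedSpace.locallyCompactSpace (EuclideanSpace ℝ (Fin k)) K
  have : ProperSpace E := FiniteDimensional.proper ℝ E
  have : LocallyCompactSpace G := ChartedSpace.locallyCompactSpace E G
  have : SigmaCompactSpace K := sigmaCompactSpace_of_connectedSpace K
  -- Open mapping theorem for groups: a continuous surjective homomorphism from a `σ`-compact group
  -- onto a locally compact one is open.
  have hopen : IsOpenMap ι :=
    ι.isOpenMap_of_sigmaCompact (MonoidHom.range_eq_top.1 hrange) hsm.continuous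
  have hle := finrank_le_of_isOpenMap hsm hopen 1
  let L' : EuclideanSpace ℝ (Fin k) →L[ℝ] E := mfderiv (𝓡 k) 𝓘(ℝ, E) ι 1
  let L : EuclideanSpace ℝ (Fin k) →ₗ[ℝ] E := L'
  have hL : Function.Injective L := himm 1
  have hsurj : Function.Surjective L :=
    (LinearMap.injective_iff_surjective_of_finrank_eq_finrank
      (le_antisymm (LinearMap.finrank_le_finrank_of_injective hL) hle)).1 hL
  rw [eq_top_iff]
  intro Y _
  obtain ⟨Z, hZ⟩ := hsurj Y
  exact (hmem Y).2 ⟨Z, hZ⟩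

end FullSubgroup

/-! ### Comparison of the flow with its linearization. -/

section FlowEstimate

/-- A curve does not leave an open set if it cannot do so for the first time. -/
lemma mem_of_forall_Ico_mem {M : Type*} [TopologicalSpace M] {c : ℝ → M} (hc : Continuous c)
    {N : Set M} (hN : IsOpen N) {t : ℝ}
    (h : ∀ s ∈ Set.Icc 0 t, (∀ s' ∈ Set.Ico 0 s, c s' ∈ N) → c s ∈ N) :
    ∀ s ∈ Set.Icc 0 t, c s ∈ N := by
  by_contra! hcon
  obtain ⟨s, hs, hsN⟩ := hcon
  have hcomp : IsCompact (Set.Icc 0 t ∩ c ⁻¹' Nᶜ) :=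
    isCompact_Icc.inter_right (hN.isClosed_compl.preimage hc)
  obtain ⟨m, ⟨hm, hmN⟩, hmin⟩ := hcomp.exists_isLeast ⟨s, hs, hsN⟩
  refine hmN (h m hm fun s' hs' => ?_)
  by_contra hs'N
  exact absurd (hmin ⟨⟨hs'.1, hs'.2.le.trans hm.2⟩, hs'N⟩) (not_le.2 hs'.2)

variable {E : Type v} [NormedAddCommGroup E] [NormedSpace ℝ E] [CompleteSpace E]

lemma continuous_exp_smul (A : E →L[ℝ] E) :
    Continuous fun τ : ℝ => NormedSpace.exp (τ • A) :=
  continuous_iff_continuousAt.2 fun τ => (hasDerivAt_exp_smul_const A τ).continuousAt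

/-- Growth of an approximate solution of `x' = A x`, when `exp (τ A)` is bounded by `C`. -/
lemma norm_le_of_norm_deriv_sub_le (A : E →L[ℝ] E) {C : ℝ}
    (hC : ∀ τ : ℝ, 0 ≤ τ → ‖NormedSpace.exp (τ • A)‖ ≤ C) {ε t s D : ℝ}
    (hD : ∀ τ ∈ Set.Icc 0 t, ‖NormedSpace.exp (τ • (-A))‖ ≤ D) (hε : 0 ≤ ε) (hs : 0 ≤ s)
    (hst : s ≤ t) {x x' : ℝ → E} (hx : ContinuousOn x (Set.Icc 0 s))
    (hx' : ∀ τ ∈ Set.Ico 0 s, HasDerivAt x (x' τ) τ)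
    (hA : ∀ τ ∈ Set.Ico 0 s, ‖x' τ - A (x τ)‖ ≤ ε * ‖x τ‖) :
    ‖x s‖ ≤ C * Real.exp (D * C * t * ε) * ‖x 0‖ := by
  have hC0 : 0 ≤ C := (norm_nonneg _).trans (hC 0 le_rfl)
  let _ : NormedAlgebra ℚ (E →L[ℝ] E) := NormedAlgebra.restrictScalars ℚ ℝ _
  have hinv : ∀ τ : ℝ, NormedSpace.exp (τ • A) * NormedSpace.exp (τ • (-A)) = 1 := fun τ => by
    rw [smul_neg, ← NormedSpace.exp_add_of_commute (Commute.neg_right rfl)]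
    simp
  -- Variation of constants: the derivative of `z` involves only the deviation `x' - A x`, to which
  -- Gronwall applies.
  set z : ℝ → E := fun τ => NormedSpace.exp (τ • (-A)) (x τ) with hz
  have hxz : ∀ τ, x τ = NormedSpace.exp (τ • A) (z τ) := fun τ => by
    have := congrArg (fun L : E →L[ℝ] E => L (x τ)) (hinv τ)
    simpa [hz] using this.symm
  have hxz' : ∀ τ, 0 ≤ τ → ‖x τ‖ ≤ C * ‖z τ‖ := fun τ hτ => by
    rw [hxz τ]
    exact ((NormedSpace.exp (τ • A)).le_opNorm _).trans (by gcongr; exact hC τ hτ)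
  have hzd : ∀ τ ∈ Set.Ico 0 s, HasDerivAt z
      (NormedSpace.exp (τ • (-A)) (x' τ - A (x τ))) τ := by
    intro τ hτ
    have h := (hasDerivAt_exp_smul_const (-A) τ).clm_apply (hx' τ hτ)
    convert! h using 1
    simp only [ContinuousLinearMap.mul_def, ContinuousLinearMap.comp_apply,
      neg_apply, map_neg, map_sub]
    abel
  have hnorm : ∀ τ ∈ Set.Ico 0 s, ‖NormedSpace.exp (τ • (-A))‖ ≤ D := fun τ hτ =>
    hD τ ⟨hτ.1, hτ.2.le.trans hst⟩
  have hD0 : 0 ≤ D := (norm_nonneg _).trans (hD 0 ⟨le_rfl, hs.trans hst⟩)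
  have hbound : ∀ τ ∈ Set.Ico 0 s, ‖NormedSpace.exp (τ • (-A)) (x' τ - A (x τ))‖ ≤
      (D * C * ε) * ‖z τ‖ + 0 := by
    intro τ hτ
    calc _ ≤ ‖NormedSpace.exp (τ • (-A))‖ * ‖x' τ - A (x τ)‖ := ContinuousLinearMap.le_opNorm _ _
      _ ≤ D * (ε * (C * ‖z τ‖)) := by
        gcongr
        · exact hnorm τ hτ
        · exact (hA τ hτ).trans (by gcongr; exact hxz' τ hτ.1)
      _ = _ := by ring
  have hg := norm_le_gronwallBound_of_norm_deriv_right_le (f := z) (a := 0) (b := s)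
    ((continuous_exp_smul (-A)).continuousOn.clm_apply hx) (fun τ hτ => (hzd τ hτ).hasDerivWithinAt) le_rfl hbound s
    ⟨hs, le_rfl⟩
  rw [gronwallBound_ε0, sub_zero] at hg
  have hz0 : ‖z 0‖ = ‖x 0‖ := by simp [hz]
  rw [hz0] at hg
  calc ‖x s‖ ≤ C * ‖z s‖ := hxz' s hs
    _ ≤ C * (‖x 0‖ * Real.exp (D * C * ε * s)) := by gcongr
    _ ≤ C * (‖x 0‖ * Real.exp (D * C * ε * t)) := by gcongr
    _ = _ := by
      rw [mul_right_comm _ ε t]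
      ring

variable {M : Type*} [TopologicalSpace M] [T2Space M] [ChartedSpace E M] [ProperSpace E]

/-- Near a singularity of a vector field whose linearization `A` satisfies `‖exp (τ A)‖ ≤ C` for
`τ ≥ 0`, the flow at any positive time expands distances to the singularity at most by `C + 1`. -/
theorem eventually_norm_flow_sub_le (x₀ : M) {φ : ℝ → M → M} (hφ0 : ∀ g, φ 0 g = g)
    (hφc : ∀ g, Continuous fun t => φ t g) {f : E → E} {A : E →L[ℝ] E}
    (hf0 : f (extChartAt 𝓘(ℝ, E) x₀ x₀) = 0)
    (hf : HasFDerivAt f A (extChartAt 𝓘(ℝ, E) x₀ x₀))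
    (hφ : ∀ g t, φ t g ∈ (extChartAt 𝓘(ℝ, E) x₀).source →
      HasDerivAt (fun s => extChartAt 𝓘(ℝ, E) x₀ (φ s g)) (f (extChartAt 𝓘(ℝ, E) x₀ (φ t g))) t)
    {C : ℝ} (hC : ∀ τ : ℝ, 0 ≤ τ → ‖NormedSpace.exp (τ • A)‖ ≤ C) {t : ℝ} (ht : 0 ≤ t) :
    ∀ᶠ g in 𝓝 x₀, φ t g ∈ (extChartAt 𝓘(ℝ, E) x₀).source ∧
      ‖extChartAt 𝓘(ℝ, E) x₀ (φ t g) - extChartAt 𝓘(ℝ, E) x₀ x₀‖ ≤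
        (C + 1) * ‖extChartAt 𝓘(ℝ, E) x₀ g - extChartAt 𝓘(ℝ, E) x₀ x₀‖ := by
  set κ := extChartAt 𝓘(ℝ, E) x₀ with hκ
  set p := κ x₀ with hp
  have hC0 : 0 ≤ C := (norm_nonneg _).trans (hC 0 le_rfl)
  obtain ⟨D, hD⟩ := isCompact_Icc (a := (0 : ℝ)) (b := t) |>.exists_bound_of_continuousOn
    (continuous_exp_smul (-A)).continuousOn
  -- `D` and `ε` may depend on `t`; this costs only the size of the neighborhood, not the factor `C
  -- + 1`.
  obtain ⟨ε, hε, hεC⟩ : ∃ ε > 0, C * Real.exp (D * C * t * ε) ≤ C + 1 := by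
    have hcont : Continuous fun ε : ℝ => C * Real.exp (D * C * t * ε) := by
      fun_prop
    have h := (hcont.tendsto 0).eventually_lt_const (u := C + 1) (by simp)
    obtain ⟨ε, h1, h2⟩ := ((h.filter_mono nhdsWithin_le_nhds).and
      (self_mem_nhdsWithin (s := Set.Ioi (0 : ℝ)))).exists
    exact ⟨ε, h2, le_of_lt h1⟩
  have hfε : ∀ᶠ y in 𝓝 p, ‖f y - A (y - p)‖ ≤ ε * ‖y - p‖ := by
    have := hf.isLittleO.def hε
    simpa [hf0] using this
  obtain ⟨r, hr, hball⟩ := Metric.eventually_nhds_iff_ball.1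
    (hfε.and ((isOpen_extChartAt_target x₀).mem_nhds (mem_extChartAt_target x₀)))
  set N := κ.source ∩ κ ⁻¹' Metric.ball p r with hN
  have hNo : IsOpen N :=
    (continuousOn_extChartAt x₀).isOpen_inter_preimage (isOpen_extChartAt_source x₀)
      Metric.isOpen_ball
  have hcκ : ContinuousAt κ x₀ := continuousAt_extChartAt x₀
  have hsmall : ∀ᶠ g in 𝓝 x₀, (C + 1) * ‖κ g - p‖ < r := by
    have : ContinuousAt (fun g => (C + 1) * ‖κ g - p‖) x₀ := by fun_prop
    exact this.tendsto.eventually_lt_const (by simpa [hp] using hr)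
  filter_upwards [hsmall, extChartAt_source_mem_nhds (I := 𝓘(ℝ, E)) x₀] with g hg hgs
  set ρ := (C + 1) * ‖κ g - p‖ with hρ
  have hgρ : ‖κ g - p‖ ≤ ρ := le_mul_of_one_le_left (norm_nonneg _) (by linarith)
  have hgrow : ∀ s ∈ Set.Icc 0 t, (∀ s' ∈ Set.Ico 0 s, φ s' g ∈ N) → φ s g ∈ κ.source →
      ‖κ (φ s g) - p‖ ≤ ρ := by
    intro s hs hsN hss
    have hsrc : ∀ τ ∈ Set.Icc 0 s, φ τ g ∈ κ.source := by
      intro τ hτ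
      rcases hτ.2.lt_or_eq with h | rfl
      · exact (hsN τ ⟨hτ.1, h⟩).1
      · exact hss
    have h := norm_le_of_norm_deriv_sub_le A hC hD hε.le hs.1 hs.2 (x := fun τ => κ (φ τ g) - p)
      (x' := fun τ => f (κ (φ τ g)))
      (fun τ hτ => ((hφ g τ (hsrc τ hτ)).sub_const p).continuousAt.continuousWithinAt)
      (fun τ hτ => (hφ g τ (hsrc τ ⟨hτ.1, hτ.2.le⟩)).sub_const p)
      (fun τ hτ => (hball _ (hsN τ hτ).2).1)
    simp only [hφ0] at h
    exact h.trans (mul_le_mul_of_nonneg_right hεC (norm_nonneg _))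
  -- The curve lies in this closed set before time `s`, hence also at time `s`; this rules out
  -- leaving the chart domain.
  have hK : IsClosed (κ.symm '' Metric.closedBall p ρ) := by
    refine IsCompact.isClosed ((isCompact_closedBall p ρ).image_of_continuousOn ?_)
    exact (continuousOn_extChartAt_symm x₀).mono fun y hy =>
      (hball y (Metric.closedBall_subset_ball hg hy)).2
  have hKN : κ.symm '' Metric.closedBall p ρ ⊆ N := by
    rintro _ ⟨y, hy, rfl⟩
    have hyb := Metric.closedBall_subset_ball hg hy
    have hyt := (hball y hyb).2
    refine ⟨κ.map_target hyt, ?_⟩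
    rw [Set.mem_preimage, κ.right_inv hyt]
    exact hyb
  have hstay : ∀ s ∈ Set.Icc 0 t, φ s g ∈ N := by
    refine mem_of_forall_Ico_mem (hφc g) hNo fun s hs hsN => ?_
    rcases hs.1.eq_or_lt with rfl | hs0
    · rw [hφ0]
      exact ⟨hgs, by simpa [dist_eq_norm] using hgρ.trans_lt hg⟩
    · refine hKN ?_
      have hmem : s ∈ closure (Set.Ico 0 s) := by
        rw [closure_Ico hs0.ne]
        exact ⟨hs0.le, le_rfl⟩
      refine hK.closure_subset_iff.2 ?_ (image_closure_subset_closure_image (hφc g) ⟨s, hmem, rfl⟩)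
      rintro _ ⟨s', hs', rfl⟩
      refine ⟨κ (φ s' g), ?_, κ.left_inv (hsN s' hs').1⟩
      rw [mem_closedBall_iff_norm]
      exact hgrow s' ⟨hs'.1, hs'.2.le.trans hs.2⟩
        (fun s'' hs'' => hsN s'' ⟨hs''.1, hs''.2.trans hs'.2⟩) (hsN s' hs').1
  have htt : t ∈ Set.Icc 0 t := ⟨ht, le_rfl⟩
  exact ⟨(hstay t htt).1,
    hgrow t htt (fun s hs => hstay s ⟨hs.1, hs.2.le⟩) (hstay t htt).1⟩

end FlowEstimate

/-! ### Equicontinuity of endomorphisms from infinitesimal bounds. -/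

section UniformStability

variable {E : Type v} [NormedAddCommGroup E] [NormedSpace ℝ E]
  {G : Type u} [TopologicalSpace G] [ChartedSpace E G]

/-- A smooth map of two variables is locally Lipschitz in charts. -/
lemma exists_norm_extChartAt_sub_le [IsManifold 𝓘(ℝ, E) ∞ G] {f : E × E → G} {q : E}
    (hf : ContMDiffAt 𝓘(ℝ, E × E) 𝓘(ℝ, E) ∞ f (q, q)) :
    ∃ K : ℝ, 0 < K ∧ ∃ r > 0, ∀ a ∈ Metric.ball q r, ∀ b ∈ Metric.ball q r,
      f (a, b) ∈ (extChartAt 𝓘(ℝ, E) (f (q, q))).source ∧ ∀ b' ∈ Metric.ball q r,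
        ‖extChartAt 𝓘(ℝ, E) (f (q, q)) (f (a, b)) -
          extChartAt 𝓘(ℝ, E) (f (q, q)) (f (a, b'))‖ ≤ K * ‖b - b'‖ := by
  set κ := extChartAt 𝓘(ℝ, E) (f (q, q))
  have h1 : ContDiffAt ℝ 1 (fun x => κ (f x)) (q, q) := by
    have h := (contMDiffAt_extChartAt (I := 𝓘(ℝ, E)) (n := ∞) (x := f (q, q))).comp (q, q) hf
    exact h.contDiffAt.of_le (by norm_cast)
  obtain ⟨K, t, ht, hK⟩ := h1.exists_lipschitzOnWith
  have hsrc : ∀ᶠ x in 𝓝 (q, q), f x ∈ κ.source :=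
    hf.continuousAt.eventually (extChartAt_source_mem_nhds _)
  obtain ⟨r, hr, hball⟩ := Metric.mem_nhds_iff.1 (Filter.inter_mem ht hsrc)
  rw [← ball_prod_same] at hball
  refine ⟨K + 1, by positivity, r, hr, fun a ha b hb => ⟨(hball ⟨ha, hb⟩).2, fun b' hb' => ?_⟩⟩
  have h := hK.dist_le_mul (a, b) (hball ⟨ha, hb⟩).1 (a, b') (hball ⟨ha, hb'⟩).1
  rw [dist_eq_norm, Prod.dist_eq, dist_self, dist_eq_norm b, max_eq_right (norm_nonneg _)] at h
  exact h.trans (by gcongr; simp)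

variable [Group G] [LieGroup 𝓘(ℝ, E) ∞ G]

/-- Endomorphisms of a Lie group expanding infinitesimally at the identity at most by a factor `C`
are equicontinuous. -/
theorem exists_forall_image_subset_of_eventually_le (C : ℝ) {U : Set G} (hU : U ∈ 𝓝 (1 : G)) :
    ∃ V ∈ 𝓝 (1 : G), ∀ ψ : G →* G,
      (∀ᶠ g in 𝓝 (1 : G), ψ g ∈ (extChartAt 𝓘(ℝ, E) (1 : G)).source ∧
        ‖extChartAt 𝓘(ℝ, E) (1 : G) (ψ g) - extChartAt 𝓘(ℝ, E) (1 : G) 1‖ ≤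
          C * ‖extChartAt 𝓘(ℝ, E) (1 : G) g - extChartAt 𝓘(ℝ, E) (1 : G) 1‖) →
      ψ '' V ⊆ U := by
  wlog hC : 0 ≤ C generalizing C
  · obtain ⟨V, hV, h⟩ := this |C| (abs_nonneg _)
    exact ⟨V, hV, fun ψ hψ => h ψ (hψ.mono fun g hg =>
      ⟨hg.1, hg.2.trans (by gcongr; exact le_abs_self C)⟩)⟩
  set κ := extChartAt 𝓘(ℝ, E) (1 : G) with hκ
  set p := κ 1 with hp
  have hpsymm : κ.symm p = 1 := extChartAt_to_inv (I := 𝓘(ℝ, E)) (1 : G)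
  have hsymm : ContMDiffAt 𝓘(ℝ, E) 𝓘(ℝ, E) ∞ κ.symm p :=
    (contMDiffOn_extChartAt_symm (1 : G)).contMDiffAt (extChartAt_target_mem_nhds (1 : G))
  have h1 : ContMDiffAt 𝓘(ℝ, E × E) 𝓘(ℝ, E) ∞ (fun x : E × E => κ.symm x.1) (p, p) :=
    ContMDiffAt.comp (p, p) hsymm contDiff_fst.contMDiff.contMDiffAt
  have h2 : ContMDiffAt 𝓘(ℝ, E × E) 𝓘(ℝ, E) ∞ (fun x : E × E => κ.symm x.2) (p, p) :=
    ContMDiffAt.comp (p, p) hsymm contDiff_snd.contMDiff.contMDiffAt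
  obtain ⟨K, hK, r₁, hr₁, hmul⟩ := exists_norm_extChartAt_sub_le
    (f := fun x : E × E => κ.symm x.1 * κ.symm x.2) (h1.mul h2)
  obtain ⟨L, hL, r₂, hr₂, hdiv⟩ := exists_norm_extChartAt_sub_le
    (f := fun x : E × E => (κ.symm x.1)⁻¹ * κ.symm x.2) (h1.inv.mul h2)
  simp only [hpsymm, mul_one, inv_one] at hmul hdiv
  have hUsymm : κ.symm ⁻¹' U ∈ 𝓝 p := hsymm.continuousAt.preimage_mem_nhds (by rwa [hpsymm])
  obtain ⟨r₄, hr₄, hrU⟩ := Metric.mem_nhds_iff.1 hUsymm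
  obtain ⟨r, hr, hr1, hr2, hr4⟩ : ∃ r > 0, r ≤ r₁ ∧ r ≤ r₂ ∧ r ≤ r₄ :=
    ⟨min (min r₁ r₂) r₄, by positivity, by simp, by simp, by simp⟩
  have hb1 := Metric.ball_subset_ball (x := p) hr1
  have hb2 := Metric.ball_subset_ball (x := p) hr2
  have hb4 := Metric.ball_subset_ball (x := p) hr4
  -- `K * C * L * δ` will bound the total displacement, so `δ` is fixed before `ψ` and `n`.
  obtain ⟨δ, hδ, hδr, hδK⟩ : ∃ δ > 0, δ ≤ r ∧ K * C * L * δ < r := by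
    have hpos : 0 < K * C * L + 1 := by positivity
    refine ⟨r / (K * C * L + 1), by positivity, div_le_self hr.le ?_, ?_⟩
    · have : 0 ≤ K * C * L := by positivity
      linarith
    · rw [← mul_div_assoc, div_lt_iff₀ hpos]
      nlinarith
  have hκc : ContinuousAt κ 1 := continuousAt_extChartAt (1 : G)
  refine ⟨κ.source ∩ κ ⁻¹' Metric.ball p δ, Filter.inter_mem (extChartAt_source_mem_nhds (1 : G))
    (hκc.preimage_mem_nhds (Metric.ball_mem_nhds _ hδ)), ?_⟩
  rintro ψ hψ _ ⟨g, ⟨hgs, hgδ⟩, rfl⟩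
  set w := κ g - p with hw
  have hwδ : ‖w‖ < δ := by simpa [dist_eq_norm] using hgδ
  have hψ' : ∀ᶠ a in 𝓝 p, ψ (κ.symm a) ∈ κ.source ∧
      ‖κ (ψ (κ.symm a)) - p‖ ≤ C * ‖a - p‖ := by
    have ht : Filter.Tendsto κ.symm (𝓝 p) (𝓝 1) := by
      have := hsymm.continuousAt.tendsto
      rwa [hpsymm] at this
    filter_upwards [ht.eventually hψ, extChartAt_target_mem_nhds (I := 𝓘(ℝ, E)) (1 : G)]
      with a ha hat
    rwa [κ.right_inv hat] at ha
  obtain ⟨η, hη, hψη⟩ := Metric.eventually_nhds_iff_ball.1 hψ'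
  -- `n` may depend on `ψ` through `η`: the increments must lie where `ψ` is controlled, and their
  -- images where multiplication is Lipschitz.
  obtain ⟨n, hn⟩ := exists_nat_gt (L * δ / η + C * L * δ / r)
  have hn0 : 0 < (n : ℝ) := lt_of_le_of_lt (by positivity) hn
  have hnη : L * δ / n < η := by
    rw [div_lt_comm₀ hn0 hη]
    exact lt_of_le_of_lt (le_add_of_nonneg_right (by positivity)) hn
  have hnr : C * L * δ / n < r := by
    rw [div_lt_comm₀ hn0 hr]
    exact lt_of_le_of_lt (le_add_of_nonneg_left (by positivity)) hn
  set a : ℕ → E := fun i => p + ((i : ℝ) / n) • w with ha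
  have ha_mem : ∀ i ≤ n, a i ∈ Metric.ball p r := by
    intro i hi
    rw [mem_ball_iff_norm, ha, add_sub_cancel_left, norm_smul]
    have h1 : ‖(i : ℝ) / n‖ ≤ 1 := by
      rw [Real.norm_of_nonneg (by positivity)]
      exact div_le_one_of_le₀ (by exact_mod_cast hi) hn0.le
    calc _ ≤ 1 * ‖w‖ := by gcongr
      _ < r := by linarith
  have ha_succ : ∀ i, ‖a (i + 1) - a i‖ ≤ δ / n := by
    intro i
    have : a (i + 1) - a i = (1 / (n : ℝ)) • w := by
      simp only [ha, add_sub_add_left_eq_sub, ← sub_smul]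
      push_cast
      ring_nf
    rw [this, norm_smul, Real.norm_of_nonneg (by positivity), one_div, inv_mul_eq_div]
    gcongr
  -- Left division is Lipschitz and gives `1` on the diagonal, so each increment has chart size at
  -- most `L * δ / n`.
  have hstep : ∀ i < n, ψ ((κ.symm (a i))⁻¹ * κ.symm (a (i + 1))) ∈ κ.source ∧
      ‖κ (ψ ((κ.symm (a i))⁻¹ * κ.symm (a (i + 1)))) - p‖ ≤ C * L * δ / n := by
    intro i hi
    obtain ⟨hs, hd⟩ := hdiv (a i) (hb2 (ha_mem i hi.le)) (a (i + 1)) (hb2 (ha_mem (i + 1) hi))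
    have hd' := hd (a i) (hb2 (ha_mem i hi.le))
    rw [inv_mul_cancel, ← hp] at hd'
    have hle := hd'.trans (mul_le_mul_of_nonneg_left (ha_succ i) hL.le)
    have h := hψη (κ ((κ.symm (a i))⁻¹ * κ.symm (a (i + 1))))
      (by rw [mem_ball_iff_norm]; exact hle.trans_lt (by rwa [← mul_div_assoc]))
    rw [κ.left_inv hs] at h
    refine ⟨h.1, h.2.trans ((mul_le_mul_of_nonneg_left hle hC).trans_eq (by ring))⟩
  have hind : ∀ i ≤ n, ψ (κ.symm (a i)) ∈ κ.source ∧
      ‖κ (ψ (κ.symm (a i))) - p‖ ≤ (i / n) * (K * C * L * δ) := by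
    intro i
    induction i with
    | zero =>
      intro _
      have h0 : ψ (κ.symm (a 0)) = 1 := by simp only [ha]; simp [-extChartAt, hpsymm]
      rw [h0]
      exact ⟨mem_extChartAt_source 1, by simp [-extChartAt, ← hp]⟩
    | succ i ih =>
      intro hi
      obtain ⟨hs, hle⟩ := ih (Nat.le_of_succ_le hi)
      obtain ⟨hs', hle'⟩ := hstep i hi
      set x := ψ (κ.symm (a i))
      set y := ψ ((κ.symm (a i))⁻¹ * κ.symm (a (i + 1))) with hy
      have hxy : ψ (κ.symm (a (i + 1))) = x * y := by
        rw [hy, ← map_mul, mul_inv_cancel_left]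
      have hx_mem : κ x ∈ Metric.ball p r := by
        rw [mem_ball_iff_norm]
        refine hle.trans_lt (lt_of_le_of_lt ?_ hδK)
        refine mul_le_of_le_one_left (by positivity) ?_
        exact div_le_one_of_le₀ (by exact_mod_cast Nat.le_of_succ_le hi) hn0.le
      have hy_mem : κ y ∈ Metric.ball p r := by
        rw [mem_ball_iff_norm]
        exact hle'.trans_lt hnr
      obtain ⟨hm, hm'⟩ := hmul (κ x) (hb1 hx_mem) (κ y) (hb1 hy_mem)
      have hm'' := hm' p (Metric.mem_ball_self hr₁)
      rw [κ.left_inv hs, κ.left_inv hs', hpsymm, mul_one] at hm''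
      rw [κ.left_inv hs, κ.left_inv hs'] at hm
      rw [hxy]
      refine ⟨hm, ?_⟩
      calc ‖κ (x * y) - p‖ ≤ ‖κ (x * y) - κ x‖ + ‖κ x - p‖ := norm_sub_le_norm_sub_add_norm_sub ..
        _ ≤ K * (C * L * δ / n) + (i / n) * (K * C * L * δ) := by
          gcongr
          exact hm''.trans (by gcongr)
        _ = _ := by push_cast; ring
  obtain ⟨hs, hle⟩ := hind n le_rfl
  have han : κ.symm (a n) = g := by
    simp only [ha, div_self hn0.ne', one_smul, hw, add_sub_cancel]
    exact κ.left_inv hgs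
  rw [han] at hs hle
  rw [div_self hn0.ne', one_mul] at hle
  have := hrU (hb4 (mem_ball_iff_norm.2 (hle.trans_lt hδK)))
  rwa [Set.mem_preimage, κ.left_inv hs] at this

end UniformStability

/-! ### Vector fields in charts and their linearization at a zero. -/

section Linearization

variable {E : Type v} [NormedAddCommGroup E] [NormedSpace ℝ E]
  {M : Type u} [TopologicalSpace M] [ChartedSpace E M]

/-- A vector field read in the preferred chart at `x`. -/
noncomputable def chartVectorField (X : ∀ g : M, TangentSpace 𝓘(ℝ, E) g) (x : M) : E → E :=
  VectorField.mpullbackWithin 𝓘(ℝ, E) 𝓘(ℝ, E) (extChartAt 𝓘(ℝ, E) x).symm X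
    (Set.range 𝓘(ℝ, E))

variable (X : ∀ g : M, TangentSpace 𝓘(ℝ, E) g)

lemma chartVectorField_extChartAt [IsManifold 𝓘(ℝ, E) 1 M] {x g : M}
    (hg : g ∈ (extChartAt 𝓘(ℝ, E) x).source) :
    chartVectorField X x (extChartAt 𝓘(ℝ, E) x g) =
      mfderiv 𝓘(ℝ, E) 𝓘(ℝ, E) (extChartAt 𝓘(ℝ, E) x) g (X g) := by
  have h1 := mfderivWithin_extChartAt_symm_comp_mfderiv_extChartAt' (I := 𝓘(ℝ, E)) hg
  have h2 := mfderiv_extChartAt_comp_mfderivWithin_extChartAt_symm' (I := 𝓘(ℝ, E)) hg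
  have h3 : (mfderivWithin 𝓘(ℝ, E) 𝓘(ℝ, E) (extChartAt 𝓘(ℝ, E) x).symm (Set.range 𝓘(ℝ, E))
      (extChartAt 𝓘(ℝ, E) x g)).inverse = mfderiv 𝓘(ℝ, E) 𝓘(ℝ, E) (extChartAt 𝓘(ℝ, E) x) g := by
    apply ContinuousLinearMap.inverse_eq
    · convert! h1
    · convert! h2
  rw [chartVectorField, VectorField.mpullbackWithin_apply, h3, (extChartAt 𝓘(ℝ, E) x).left_inv hg]

lemma mfderiv_extChartAt_self_eq_id [IsManifold 𝓘(ℝ, E) 1 M] (x : M) :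
    (mfderiv 𝓘(ℝ, E) 𝓘(ℝ, E) (extChartAt 𝓘(ℝ, E) x) x : E →L[ℝ] E) =
      ContinuousLinearMap.id ℝ E :=
  mfderiv_extChartAt_self

lemma chartVectorField_self [IsManifold 𝓘(ℝ, E) 1 M] (x : M) :
    chartVectorField X x (extChartAt 𝓘(ℝ, E) x x) = X x :=
  (chartVectorField_extChartAt X (mem_extChartAt_source x)).trans
    (congrArg (fun L : E →L[ℝ] E => L (X x)) (mfderiv_extChartAt_self_eq_id x))

variable {X}

lemma hasDerivAt_extChartAt_of_isMIntegralCurve [IsManifold 𝓘(ℝ, E) 1 M] {c : ℝ → M}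
    (hc : IsMIntegralCurve (I := 𝓘(ℝ, E)) c X) {x : M} {t : ℝ}
    (ht : c t ∈ (extChartAt 𝓘(ℝ, E) x).source) :
    HasDerivAt (fun s => extChartAt 𝓘(ℝ, E) x (c s))
      (chartVectorField X x (extChartAt 𝓘(ℝ, E) x (c t))) t := by
  rw [chartVectorField_extChartAt X ht]
  have h := ((mdifferentiableAt_extChartAt (I := 𝓘(ℝ, E))
    (by rwa [extChartAt_source] at ht)).hasMFDerivAt).comp t (hc t)
  let L : E →L[ℝ] E := mfderiv 𝓘(ℝ, E) 𝓘(ℝ, E) (extChartAt 𝓘(ℝ, E) x) (c t)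
  let w : E := X (c t)
  have h' : HasFDerivAt (fun s => extChartAt 𝓘(ℝ, E) x (c s))
      (L.comp ((1 : ℝ →L[ℝ] ℝ).smulRight w)) t := hasMFDerivAt_iff_hasFDerivAt.1 h
  have h'' : HasDerivAt (fun s => extChartAt 𝓘(ℝ, E) x (c s)) (L w) t := by
    simpa [-extChartAt] using h'.hasDerivAt
  exact h''

lemma differentiableAt_chartVectorField [CompleteSpace E] [IsManifold 𝓘(ℝ, E) 2 M] {x : M}
    (hX : MDifferentiableAt 𝓘(ℝ, E) 𝓘(ℝ, E).tangent
      (fun g => (⟨g, X g⟩ : TangentBundle 𝓘(ℝ, E) M)) x) :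
    DifferentiableAt ℝ (chartVectorField X x) (extChartAt 𝓘(ℝ, E) x x) := by
  have h := MDifferentiableWithinAt.differentiableWithinAt_mpullbackWithin_vectorField
    (s := Set.univ) (V := X) (x := x) (I := 𝓘(ℝ, E)) hX.mdifferentiableWithinAt
  have hu : (extChartAt 𝓘(ℝ, E) x).symm ⁻¹' Set.univ ∩ Set.range 𝓘(ℝ, E) = Set.univ := by simp
  rw [hu] at h
  exact differentiableWithinAt_univ.1 h

/-- The bracket with a vector field vanishing at `x` is given by its linearization. -/
lemma mlieBracket_eq_neg_fderiv_chartVectorField [IsManifold 𝓘(ℝ, E) 1 M] {x : M} (hX : X x = 0)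
    (Y : ∀ g : M, TangentSpace 𝓘(ℝ, E) g) :
    (VectorField.mlieBracket 𝓘(ℝ, E) X Y x : E) =
      -fderiv ℝ (chartVectorField X x) (extChartAt 𝓘(ℝ, E) x x) (Y x) := by
  have hu : (extChartAt 𝓘(ℝ, E) x).symm ⁻¹' Set.univ ∩ Set.range 𝓘(ℝ, E) = Set.univ := by simp
  -- The derivative of the second field is applied to the zero of the first, so only one bracket
  -- term survives.
  have key : ∀ (L : E →L[ℝ] E) (f g : E → E) (p y : E), L = ContinuousLinearMap.id ℝ E →
      f p = 0 → g p = y → L.inverse (VectorField.lieBracketWithin ℝ f g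
        ((extChartAt 𝓘(ℝ, E) x).symm ⁻¹' Set.univ ∩ Set.range 𝓘(ℝ, E)) p) = -fderiv ℝ f p y := by
    intro L f g p y hL hf hg
    rw [hu, hL, ContinuousLinearMap.inverse_id, ContinuousLinearMap.id_apply,
      VectorField.lieBracketWithin, fderivWithin_univ, fderivWithin_univ, hf, hg, map_zero,
      zero_sub]
  exact key _ _ _ _ _ (mfderiv_extChartAt_self_eq_id x) ((chartVectorField_self X x).trans hX)
    (chartVectorField_self Y x)

end Linearization

/-! ### The derivation as linearization; uniqueness of the flow. -/

section Derivation

variable {E : Type v} [NormedAddCommGroup E] [NormedSpace ℝ E] [FiniteDimensional ℝ E]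
  {G : Type u} [TopologicalSpace G] [ChartedSpace E G] [Group G] [LieGroup 𝓘(ℝ, E) ∞ G]
  {X : ∀ g : G, TangentSpace 𝓘(ℝ, E) g}

/-- The derivation of a vector field vanishing at the identity is its linearization there. -/
lemma derivation_eq_fderiv (hX : X 1 = 0) :
    derivation X = (fderiv ℝ (chartVectorField X 1) (extChartAt 𝓘(ℝ, E) (1 : G) 1) : E →ₗ[ℝ] E) := by
  refine LinearMap.ext fun Y => ?_
  have h1 : (mulInvariantVectorField (I := 𝓘(ℝ, E)) Y (1 : G) : E) = Y := by
    have h : (fun x : G => 1 * x) = id := by ext; simp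
    simp only [mulInvariantVectorField]
    rw [h, mfderiv_id]
    rfl
  have h2 : (derivation X Y : E) = - -(fderiv ℝ (chartVectorField X 1)
      (extChartAt 𝓘(ℝ, E) (1 : G) 1) (mulInvariantVectorField (I := 𝓘(ℝ, E)) Y (1 : G) : E)) :=
    congrArg (fun z : E => -z) (mlieBracket_eq_neg_fderiv_chartVectorField hX _)
  rw [neg_neg, h1] at h2
  exact h2

variable [T2Space G]

/-- The flow of a linear vector field consists of automorphisms. -/
lemma IsFlowOf.exists_mulEquiv (hX : IsLinearVectorField X) {φ : ℝ → G → G}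
    (hφ : IsFlowOf X φ) : ∃ ψ : ℝ → G ≃* G, ∀ t g, φ t g = ψ t g := by
  have : CompleteSpace E := FiniteDimensional.complete ℝ E
  obtain ⟨ψ, hψ⟩ := hX.exists_flow
  refine ⟨ψ, fun t g => ?_⟩
  have := isMIntegralCurve_Ioo_eq_of_contMDiff_boundaryless (t₀ := 0)
    (hX.contMDiff.of_le (by norm_cast)) (hφ.isMIntegralCurve g) (hψ.isMIntegralCurve g)
    (by rw [hφ.map_zero, hψ.map_zero])
  exact congrFun this t

end Derivation

lemma eq_zero_of_isMIntegralCurve_const {E : Type v} [NormedAddCommGroup E] [NormedSpace ℝ E]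
    {M : Type u} [TopologicalSpace M] [ChartedSpace E M] [IsManifold 𝓘(ℝ, E) 1 M]
    {X : ∀ g : M, TangentSpace 𝓘(ℝ, E) g} {x : M}
    (h : IsMIntegralCurve (I := 𝓘(ℝ, E)) (fun _ => x) X) : X x = 0 := by
  have h1 := hasDerivAt_extChartAt_of_isMIntegralCurve h (t := 0)
    (mem_extChartAt_source (I := 𝓘(ℝ, E)) x)
  rw [chartVectorField_self] at h1
  exact h1.unique (hasDerivAt_const (0 : ℝ) _)

end LinearFlow

open LinearFlow in
theorem theorem4p6
    {E : Type v} [NormedAddCommGroup E] [NormedSpace ℝ E] [FiniteDimensional ℝ E]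
    {G : Type u} [TopologicalSpace G] [T2Space G] [ConnectedSpace G] [ChartedSpace E G] [Group G]
    [LieGroup 𝓘(ℝ, E) ∞ G]
    (X : ∀ g : G, TangentSpace 𝓘(ℝ, E) g) (hX : IsLinearVectorField X)
    (φ : ℝ → G → G) (hφ : IsFlowOf X φ)
    (Gsc : Subgroup G)
    (hGsc : IsConnectedLieSubgroup Gsc (stableCentralSubspace (derivation X)))
    (hG : Gsc = ⊤)
    (hD : (centralRestriction (derivation X)).IsSemisimple) :
    IsStableFixedPoint φ (1 : G) := by
  have : CompleteSpace E := FiniteDimensional.complete ℝ E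
  have : ProperSpace E := FiniteDimensional.proper ℝ E
  subst hG
  obtain ⟨ψ, hψ⟩ := hφ.exists_mulEquiv hX
  have hfix : ∀ t, φ t 1 = 1 := fun t => by rw [hψ, map_one]
  have hX1 : X 1 = 0 := by
    have h := hφ.isMIntegralCurve 1
    simp only [hfix] at h
    exact eq_zero_of_isMIntegralCurve_const h
  set A : E →L[ℝ] E := fderiv ℝ (chartVectorField X 1) (extChartAt 𝓘(ℝ, E) (1 : G) 1) with hA
  obtain ⟨C, hC⟩ : ∃ C, ∀ t : ℝ, 0 ≤ t → ‖NormedSpace.exp (t • A)‖ ≤ C := by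
    have htop := hGsc.eq_top
    rw [derivation_eq_fderiv hX1] at htop hD
    exact exists_norm_exp_smul_le A htop hD
  have hd : HasFDerivAt (chartVectorField X 1) A (extChartAt 𝓘(ℝ, E) (1 : G) 1) :=
    (differentiableAt_chartVectorField
      (hX.contMDiff.mdifferentiable (by simp)).mdifferentiableAt).hasFDerivAt
  refine ⟨hfix, fun U hU => ?_⟩
  -- `V` depends only on `C + 1` and `U`, so it is available before `t` is introduced.
  obtain ⟨V, hV, hVU⟩ := exists_forall_image_subset_of_eventually_le (E := E) (C + 1) hU
  refine ⟨V, hV, fun t ht => ?_⟩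
  have hev := eventually_norm_flow_sub_le (1 : G) hφ.map_zero
    (fun g => (hφ.isMIntegralCurve g).continuous) ((chartVectorField_self X 1).trans hX1) hd
    (fun g t htg => hasDerivAt_extChartAt_of_isMIntegralCurve (hφ.isMIntegralCurve g) htg) hC ht
  simp only [hψ] at hev
  have := hVU (ψ t : G →* G) hev
  rintro _ ⟨g, hg, rfl⟩
  rw [hψ]
  exact this ⟨g, hg, rfl⟩
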